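/- For positive integers $s_1,\dots,s_r$ with $s_1>1$ let $$\zeta^\star(s_1,\dots,s_r)=\sum_{k_1\ge\cdots\ge k_r\ge 1}\frac{1}{k_1^{s_1}\cdots k_r^{s_r}},$$ with value $1$ for the empty index ($r=0$), and let $\{a_1,\dots,a_n\}^d$ denote $d$ successive repetitions of the sequence $a_1,\dots,a_n$. Let $m$ be a non-negative integer. Then the series defining $\zeta^\star(\{\{2\}^m,3,\{2\}^m,1\}^d)$ and $\zeta^\star(\{\{2\}^m,3,\{2\}^m,1\}^d,\{2\}^{m+1})$ converge for all $d\ge 0$, and for every complex $z$ with $|z|<1$ both series in $z$ below converge absolutely and $$\sum_{d=0}^{\infty}\zeta^\star(\{\{2\}^m,3,\{2\}^m,1\}^d)\,z^{4(m+1)d}-\sum_{d=0}^{\infty}\zeta^\star(\{\{2\}^m,3,\{2\}^m,1\}^d,\{2\}^{m+1})\,z^{2(m+1)(2d+1)} =-i\prod_{k=0}^{m}\tan\left(\frac{\pi z}{2}\,e^{\frac{\pi i(2k+1)}{2(m+1)}}\right)\cot\left(\frac{\pi z}{2}\,e^{\frac{\pi i k}{m+1}}\right),$$ where at $z=0$ the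 right-hand side, which has a removable singularity there, is understood as its limit as $z\to 0$. -/

import Mathlib

open Filter Topology

/-- The index set of the multiple zeta star sum of depth `r`: tuples `k₁ ≥ ⋯ ≥ k_r ≥ 1`. -/
abbrev StarIndex (r : ℕ) : Type :=
  {k : Fin r → ℕ // Antitone k ∧ ∀ j, 1 ≤ k j}

/-- The summand `1 / (k₁ ^ s₁ ⋯ k_r ^ s_r)`. -/
noncomputable def starTerm (s : List ℕ) (k : StarIndex s.length) : ℝ :=
  ∏ j : Fin s.length, 1 / (k.1 j : ℝ) ^ s.get j

/-- The multiple zeta star value `ζ⋆(s₁, …, s_r)`; the empty index gives the value `1`. -/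
noncomputable def zetaStar (s : List ℕ) : ℝ :=
  ∑' k : StarIndex s.length, starTerm s k

/-- The multi-index `{{2}^m, 3, {2}^m, 1}^d`. -/
def idxA (m d : ℕ) : List ℕ :=
  (List.replicate d (List.replicate m 2 ++ [3] ++ List.replicate m 2 ++ [1])).flatten

/-- The multi-index `{{2}^m, 3, {2}^m, 1}^d, {2}^(m+1)`. -/
def idxB (m d : ℕ) : List ℕ :=
  idxA m d ++ List.replicate (m + 1) 2

/-- The difference of the two generating series. -/
noncomputable def starGenFun (m : ℕ) (z : ℂ) : ℂ :=
  (∑' d : ℕ, (zetaStar (idxA m d) : ℂ) * z ^ (4 * (m + 1) * d)) -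
    ∑' d : ℕ, (zetaStar (idxB m d) : ℂ) * z ^ (2 * (m + 1) * (2 * d + 1))

/-- The product of tangents and cotangents; its formula has a removable singularity at `z = 0`. -/
noncomputable def tanCotProd (m : ℕ) (z : ℂ) : ℂ :=
  -Complex.I * ∏ k ∈ Finset.range (m + 1),
    (Complex.tan ((Real.pi * z / 2) *
        Complex.exp (Real.pi * Complex.I * (2 * k + 1) / (2 * (m + 1)))) *
      Complex.cot ((Real.pi * z / 2) *
        Complex.exp (Real.pi * Complex.I * k / (m + 1))))

/-! ### Truncated sums as linear operators -/

/-! Put x = z^(2(m+1)). Let T be the truncated-sum operator of the block {2}^m, 3, {2}^m, 1 and B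
that of {2}^(m+1). The truncated generating function Σ_d x^(2d) T^d (1 - x B 1) solves G = (1 - x B
1) + x² T G, so it suffices to find a bounded solution of this equation in closed form and let n →
∞.

The solution is an expansion in the weights w(n,k) = n!²/((n-k)!(n+k)!). Summation with exponent 2
multiplies w(·,k) by 1/k². The exponents 1 and 3 are reduced to exponent 2 by a summation by parts
(`mul_weightSum_sub`), which trades a factor n for a factor k and differences E_k - E_(k-1) for sums
E_k + E_(k-1). The products P_k of `starProd` satisfy P_k - P_(k-1) = (-1)^k x/k^(2(m+1)) (P_k +
P_(k-1)), which closes the loop: G = 1 + Σ_k (P_k - P_(k-1)) w(·,k) solves the equation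
(`truncGen_eq`).

Iterating the equation leaves a remainder x^(2N) T^N G. It vanishes because T^N is bounded
independently of N. As n → ∞ the weights tend to 1, the sum telescopes, and the generating function
equals lim P_k. Factoring over roots of unity turns this limit into sine products, and the
double-angle formula yields the tangents and cotangents. -/

/-- The operator `f ↦ (n ↦ ∑_{1 ≤ j ≤ n} f j / j ^ s)` on sequences indexed by the positive
integers; the index `n : ℕ` stands for the positive integer `n + 1`. -/
noncomputable def truncOp (K : Type*) [Field K] (s : ℕ) : Module.End K (ℕ → K) where
  toFun f n := ∑ j ∈ Finset.range (n + 1), f j / ((j : K) + 1) ^ s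
  map_add' f g := by
    funext n
    simp [add_div, Finset.sum_add_distrib]
  map_smul' c f := by
    funext n
    simp [mul_div_assoc, Finset.mul_sum]

theorem truncOp_apply {K : Type*} [Field K] (s : ℕ) (f : ℕ → K) (n : ℕ) :
    truncOp K s f n = ∑ j ∈ Finset.range (n + 1), f j / ((j : K) + 1) ^ s := rfl

/-- The composite of the operators `truncOp` along a multi-index. -/
noncomputable def starOp (K : Type*) [Field K] (s : List ℕ) : Module.End K (ℕ → K) :=
  (s.map (truncOp K)).prod

theorem starOp_nil {K : Type*} [Field K] (f : ℕ → K) : starOp K [] f = f := rfl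

theorem starOp_cons {K : Type*} [Field K] (a : ℕ) (s : List ℕ) (f : ℕ → K) :
    starOp K (a :: s) f = truncOp K a (starOp K s f) := by
  simp [starOp]

theorem starOp_append {K : Type*} [Field K] (s t : List ℕ) :
    starOp K (s ++ t) = starOp K s * starOp K t := by
  simp [starOp]

theorem starOp_flatten_replicate {K : Type*} [Field K] (s : List ℕ) (d : ℕ) :
    starOp K (List.replicate d s).flatten = starOp K s ^ d := by
  induction d with
  | zero => simp [starOp]
  | succ d ih => rw [List.replicate_succ, List.flatten_cons, starOp_append, ih, pow_succ']

theorem starOp_ofReal (s : List ℕ) (f : ℕ → ℝ) (n : ℕ) :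
    starOp ℂ s (fun n => (f n : ℂ)) n = ((starOp ℝ s f n : ℝ) : ℂ) := by
  induction s generalizing n with
  | nil => rfl
  | cons a s ih => simp [starOp_cons, truncOp_apply, ih]

theorem starOp_one_ofReal (s : List ℕ) (n : ℕ) :
    starOp ℂ s 1 n = ((starOp ℝ s 1 n : ℝ) : ℂ) := by
  rw [← starOp_ofReal]
  congr 1

theorem norm_starOp_le (s : List ℕ) (f : ℕ → ℂ) (n : ℕ) :
    ‖starOp ℂ s f n‖ ≤ starOp ℝ s (fun n => ‖f n‖) n := by
  induction s generalizing n with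
  | nil => exact le_rfl
  | cons a s ih =>
    simp only [starOp_cons, truncOp_apply]
    refine (norm_sum_le _ _).trans (Finset.sum_le_sum fun j _ => ?_)
    rw [norm_div, norm_pow]
    have h : ‖(j : ℂ) + 1‖ = (j : ℝ) + 1 := by
      rw [← Nat.cast_succ, Complex.norm_natCast, Nat.cast_succ]
    rw [h]
    gcongr
    exact ih j

theorem starOp_mono (s : List ℕ) {f g : ℕ → ℝ} (h : ∀ n, f n ≤ g n) (n : ℕ) :
    starOp ℝ s f n ≤ starOp ℝ s g n := by
  induction s generalizing n with
  | nil => exact h n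
  | cons a s ih =>
    simp only [starOp_cons, truncOp_apply]
    gcongr
    exact ih _

theorem starOp_nonneg (s : List ℕ) {f : ℕ → ℝ} (h : ∀ n, 0 ≤ f n) (n : ℕ) :
    0 ≤ starOp ℝ s f n := by
  have := starOp_mono s (f := 0) h n
  rwa [map_zero] at this

/-! ### A uniform bound -/

/-- A fixed point of `truncOp ℝ 2`. -/
noncomputable def majorant (n : ℕ) : ℝ := 2 * (n + 1) / (n + 2)

theorem one_le_majorant (n : ℕ) : 1 ≤ majorant n := by
  have : (0 : ℝ) ≤ n := n.cast_nonneg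
  rw [majorant, le_div_iff₀ (by positivity)]
  linarith

theorem majorant_le_two (n : ℕ) : majorant n ≤ 2 := by
  have : (0 : ℝ) ≤ n := n.cast_nonneg
  rw [majorant, div_le_iff₀ (by positivity)]
  linarith

/-- The sum telescopes: `majorant j / (j + 1) ^ 2` is 2/(j+1) - 2/(j+2). -/
theorem truncOp_two_majorant (c : ℝ) (n : ℕ) :
    truncOp ℝ 2 (fun n => c * majorant n) n = c * majorant n := by
  induction n with
  | zero => simp [truncOp_apply, majorant]
  | succ n ih =>
    rw [truncOp_apply, Finset.sum_range_succ, ← truncOp_apply, ih]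
    simp only [majorant]
    push_cast
    field_simp
    ring

theorem truncOp_two_le_majorant {c : ℝ} {f : ℕ → ℝ} (hf : ∀ n, f n ≤ c * majorant n) (n : ℕ) :
    truncOp ℝ 2 f n ≤ c * majorant n := by
  rw [← truncOp_two_majorant c n]
  simp only [truncOp_apply]
  gcongr
  exact hf _

theorem starOp_replicate_two_le_majorant (k : ℕ) {c : ℝ} {f : ℕ → ℝ}
    (hf : ∀ n, f n ≤ c * majorant n) (n : ℕ) :
    starOp ℝ (List.replicate k 2) f n ≤ c * majorant n := by
  induction k generalizing n with
  | zero => exact hf n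
  | succ k ih =>
    rw [List.replicate_succ, starOp_cons]
    exact truncOp_two_le_majorant ih n

theorem sum_div_le_mul_truncOp_two {h : ℕ → ℝ} (hh : ∀ n, 0 ≤ h n) (n : ℕ) :
    ∑ j ∈ Finset.range (n + 1), h j / ((j : ℝ) + 1) ≤ (n + 1) * truncOp ℝ 2 h n := by
  rw [truncOp_apply, Finset.mul_sum]
  refine Finset.sum_le_sum fun j hj => ?_
  have hjn : (j : ℝ) ≤ n := by exact_mod_cast Nat.lt_succ_iff.mp (Finset.mem_range.mp hj)
  have h0 := hh j
  rw [mul_div_assoc', div_le_div_iff₀ (by positivity) (by positivity)]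
  have : 0 ≤ h j * (j + 1) * (n - j) := mul_nonneg (by positivity) (by linarith)
  nlinarith

/-- A factor j + 1 under the sum is at most the outer n + 1, so it can be carried outwards through
every exponent 2. -/
theorem starOp_replicate_two_le_mul (k : ℕ) {g h : ℕ → ℝ} (hh : ∀ n, 0 ≤ h n)
    (hg : ∀ n : ℕ, g n ≤ (n + 1) * h n) (n : ℕ) :
    starOp ℝ (List.replicate k 2) g n ≤ (n + 1) * starOp ℝ (List.replicate k 2) h n := by
  induction k generalizing n with
  | zero => exact hg n
  | succ k ih =>
    rw [List.replicate_succ, starOp_cons, starOp_cons]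
    refine le_trans ?_ (sum_div_le_mul_truncOp_two (starOp_nonneg _ hh) n)
    rw [truncOp_apply]
    refine Finset.sum_le_sum fun j _ => ?_
    rw [div_le_div_iff₀ (by positivity) (by positivity)]
    have := mul_le_mul_of_nonneg_right (ih j) (by positivity : (0 : ℝ) ≤ j + 1)
    nlinarith

/-- The repeated block `{2}^m, 3, {2}^m, 1`. -/
def starBlock (m : ℕ) : List ℕ := List.replicate m 2 ++ [3] ++ List.replicate m 2 ++ [1]

theorem starOp_starBlock {K : Type*} [Field K] (m : ℕ) (f : ℕ → K) :
    starOp K (starBlock m) f = starOp K (List.replicate m 2)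
      (truncOp K 3 (starOp K (List.replicate m 2) (truncOp K 1 f))) := by
  simp only [starBlock, starOp_append, Module.End.mul_apply, starOp_cons, starOp_nil]

theorem starOp_idxA {K : Type*} [Field K] (m d : ℕ) :
    starOp K (idxA m d) = starOp K (starBlock m) ^ d :=
  starOp_flatten_replicate _ _

theorem starOp_idxB {K : Type*} [Field K] (m d : ℕ) :
    starOp K (idxB m d) = starOp K (starBlock m) ^ d * starOp K (List.replicate (m + 1) 2) := by
  rw [idxB, starOp_append, starOp_idxA]

/-- The block is dominated by {2}^(2m+2): since k_i ≥ k_j for i ≤ j, 1/(k_i³ k_j) ≤ 1/(k_i² k_j²),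
and exponent 2 preserves the majorant. The bound is therefore uniform in the number of blocks. -/
theorem starOp_starBlock_le_majorant (m : ℕ) {c : ℝ} {f : ℕ → ℝ} (h0 : ∀ n, 0 ≤ f n)
    (hf : ∀ n, f n ≤ c * majorant n) (n : ℕ) :
    starOp ℝ (starBlock m) f n ≤ c * majorant n := by
  rw [starOp_starBlock]
  refine starOp_replicate_two_le_majorant m (fun n => ?_) n
  have h2 : ∀ n, 0 ≤ truncOp ℝ 2 f n := fun n => by
    simpa [starOp_cons, starOp_nil] using starOp_nonneg [2] h0 n
  have h1 : ∀ n : ℕ, truncOp ℝ 1 f n ≤ (n + 1) * truncOp ℝ 2 f n := fun n => by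
    simpa [truncOp_apply] using sum_div_le_mul_truncOp_two h0 n
  have h3 := starOp_replicate_two_le_majorant m (truncOp_two_le_majorant hf)
  refine le_trans ?_ (truncOp_two_le_majorant h3 n)
  rw [truncOp_apply, truncOp_apply]
  refine Finset.sum_le_sum fun j _ => ?_
  rw [div_le_div_iff₀ (by positivity) (by positivity)]
  have := mul_le_mul_of_nonneg_right (starOp_replicate_two_le_mul m h2 h1 j)
    (by positivity : (0 : ℝ) ≤ (j + 1) ^ 2)
  nlinarith

theorem starOp_starBlock_pow_le_majorant (m d : ℕ) {c : ℝ} {f : ℕ → ℝ} (h0 : ∀ n, 0 ≤ f n)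
    (hf : ∀ n, f n ≤ c * majorant n) (n : ℕ) :
    (starOp ℝ (starBlock m) ^ d) f n ≤ c * majorant n := by
  induction d generalizing f n with
  | zero => exact hf n
  | succ d ih =>
    rw [pow_succ, Module.End.mul_apply]
    exact ih (starOp_nonneg _ h0) (starOp_starBlock_le_majorant m h0 hf) n

theorem starOp_idxA_le_two (m d n : ℕ) : starOp ℝ (idxA m d) 1 n ≤ 2 := by
  rw [starOp_idxA]
  refine (starOp_starBlock_pow_le_majorant m d (c := 1) (fun _ => zero_le_one) (fun n => ?_) n).trans
    ?_
  · simpa using one_le_majorant n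
  · simpa using majorant_le_two n

theorem starOp_idxB_le_two (m d n : ℕ) : starOp ℝ (idxB m d) 1 n ≤ 2 := by
  rw [starOp_idxB, Module.End.mul_apply]
  refine (starOp_starBlock_pow_le_majorant m d (c := 1) (starOp_nonneg _ fun _ => zero_le_one)
    (starOp_replicate_two_le_majorant _ fun n => ?_) n).trans ?_
  · simpa using one_le_majorant n
  · simpa using majorant_le_two n

/-! ### Multiple zeta star values as limits of truncated sums -/

open scoped Classical in
/-- The tuples `N ≥ k₁ ≥ ⋯ ≥ k_r ≥ 1`. -/
noncomputable def antitoneBox (r N : ℕ) : Finset (Fin r → ℕ) :=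
  (Fintype.piFinset fun _ => Finset.Icc 1 N).filter Antitone

theorem mem_antitoneBox {r N : ℕ} {k : Fin r → ℕ} :
    k ∈ antitoneBox r N ↔ (∀ i, 1 ≤ k i ∧ k i ≤ N) ∧ Antitone k := by
  simp [antitoneBox, Fintype.mem_piFinset]

theorem antitone_cons_iff {r : ℕ} {a : ℕ} {k : Fin r → ℕ} :
    Antitone (Fin.cons a k : Fin (r + 1) → ℕ) ↔ (∀ i, k i ≤ a) ∧ Antitone k := by
  constructor
  · intro h
    refine ⟨fun i => ?_, fun i j hij => ?_⟩
    · simpa using h (Fin.zero_le i.succ)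
    · simpa using h (Fin.succ_le_succ_iff.mpr hij)
  · rintro ⟨h1, h2⟩ i j hij
    induction i using Fin.cases with
    | zero =>
      induction j using Fin.cases with
      | zero => exact le_rfl
      | succ j => simpa using h1 j
    | succ i =>
      induction j using Fin.cases with
      | zero => exact absurd hij (by simp)
      | succ j => simpa using h2 (Fin.succ_le_succ_iff.mp hij)

/-- Fixing the largest entry k₁ = j + 1 leaves a tuple bounded by j + 1, which is the recursion
defining `starOp`. -/
theorem sum_antitoneBox_succ (r N : ℕ) (F : (Fin (r + 1) → ℕ) → ℝ) :
    ∑ k ∈ antitoneBox (r + 1) N, F k =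
      ∑ j ∈ Finset.range N, ∑ k ∈ antitoneBox r (j + 1), F (Fin.cons (j + 1) k) := by
  rw [Finset.sum_sigma']
  symm
  refine Finset.sum_bij' (fun p _ => (Fin.cons (p.1 + 1) p.2 : Fin (r + 1) → ℕ))
    (fun k _ => ⟨k 0 - 1, Fin.tail k⟩) ?_ ?_ ?_ ?_ ?_
  · rintro ⟨j, k⟩ h
    simp only [Finset.mem_sigma, Finset.mem_range, mem_antitoneBox] at h
    obtain ⟨hj, hk, ha⟩ := h
    rw [mem_antitoneBox]
    refine ⟨fun i => ?_, antitone_cons_iff.mpr ⟨fun i => (hk i).2, ha⟩⟩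
    induction i using Fin.cases with
    | zero => simpa using hj
    | succ i =>
      have := hk i
      simp only [Fin.cons_succ]
      omega
  · intro k h
    rw [mem_antitoneBox] at h
    obtain ⟨hk, ha⟩ := h
    rw [← Fin.cons_self_tail k, antitone_cons_iff] at ha
    have h0 := hk 0
    simp only [Finset.mem_sigma, Finset.mem_range, mem_antitoneBox]
    refine ⟨by omega, fun i => ⟨(hk i.succ).1, ?_⟩, ha.2⟩
    have := ha.1 i
    omega
  · rintro ⟨j, k⟩ _
    simp
  · intro k h
    have h0 := (mem_antitoneBox.mp h).1 0
    simp only [Nat.sub_add_cancel h0.1, Fin.cons_self_tail]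
  · intro _ _
    rfl

theorem sum_antitoneBox_eq_starOp (s : List ℕ) (n : ℕ) :
    ∑ k ∈ antitoneBox s.length (n + 1), ∏ j : Fin s.length, 1 / (k j : ℝ) ^ s.get j =
      starOp ℝ s 1 n := by
  induction s generalizing n with
  | nil =>
    have : antitoneBox ([] : List ℕ).length (n + 1) = {Fin.elim0} := by
      ext k
      simp only [mem_antitoneBox, Finset.mem_singleton]
      exact ⟨fun _ => funext fun i => i.elim0, fun _ => ⟨fun i => i.elim0, fun i => i.elim0⟩⟩
    rw [this]
    simp [starOp_nil]
  | cons a s ih =>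
    rw [starOp_cons, truncOp_apply]
    refine (sum_antitoneBox_succ s.length (n + 1) _).trans (Finset.sum_congr rfl fun j _ => ?_)
    rw [← ih, Finset.sum_div]
    refine Finset.sum_congr rfl fun k _ => ?_
    refine (Fin.prod_univ_succ _).trans ?_
    simp only [Fin.cons_zero, Fin.cons_succ, List.get_cons_zero, List.get_cons_succ']
    push_cast
    ring

open scoped Classical in
/-- The indices of the star sum all of whose entries are at most `n + 1`. -/
noncomputable def starBox (r n : ℕ) : Finset (StarIndex r) :=
  (antitoneBox r (n + 1)).subtype fun k => Antitone k ∧ ∀ j, 1 ≤ k j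

theorem mem_starBox {r n : ℕ} {k : StarIndex r} : k ∈ starBox r n ↔ ∀ i, k.1 i ≤ n + 1 := by
  rw [starBox, Finset.mem_subtype, mem_antitoneBox]
  exact ⟨fun h i => (h.1 i).2, fun h => ⟨fun i => ⟨k.2.2 i, h i⟩, k.2.1⟩⟩

theorem sum_starBox_eq_starOp (s : List ℕ) (n : ℕ) :
    ∑ k ∈ starBox s.length n, starTerm s k = starOp ℝ s 1 n := by
  classical
  rw [← sum_antitoneBox_eq_starOp, starBox]
  exact Finset.sum_subtype_of_mem
    (f := fun k : Fin s.length → ℕ => ∏ j : Fin s.length, 1 / (k j : ℝ) ^ s.get j)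
    fun k hk => ⟨(mem_antitoneBox.mp hk).2, fun j => ((mem_antitoneBox.mp hk).1 j).1⟩

theorem tendsto_starBox (r : ℕ) : Tendsto (starBox r) atTop atTop := by
  refine tendsto_atTop_finset_of_monotone (fun a b hab k hk => ?_) fun k => ?_
  · rw [mem_starBox] at hk ⊢
    exact fun i => (hk i).trans (by omega)
  · refine ⟨∑ i, k.1 i, mem_starBox.mpr fun i => ?_⟩
    exact (Finset.single_le_sum (fun _ _ => Nat.zero_le _) (Finset.mem_univ i)).trans
      (Nat.le_succ _)

theorem starTerm_nonneg (s : List ℕ) (k : StarIndex s.length) : 0 ≤ starTerm s k :=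
  Finset.prod_nonneg fun _ _ => by positivity

theorem summable_starTerm {s : List ℕ} {c : ℝ} (h : ∀ n, starOp ℝ s 1 n ≤ c) :
    Summable (starTerm s) := by
  refine summable_of_sum_le (c := c) (starTerm_nonneg s) fun u => ?_
  obtain ⟨n, hn⟩ := ((tendsto_starBox s.length).eventually (eventually_ge_atTop u)).exists
  refine (Finset.sum_le_sum_of_subset_of_nonneg hn fun k _ _ => starTerm_nonneg s k).trans ?_
  rw [sum_starBox_eq_starOp]
  exact h n

theorem tendsto_starOp_zetaStar {s : List ℕ} (h : Summable (starTerm s)) :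
    Tendsto (starOp ℝ s 1) atTop (𝓝 (zetaStar s)) := by
  refine (h.hasSum.comp (tendsto_starBox s.length)).congr fun n => ?_
  exact sum_starBox_eq_starOp s n

theorem summable_starTerm_idxA (m d : ℕ) : Summable (starTerm (idxA m d)) :=
  summable_starTerm (starOp_idxA_le_two m d)

theorem summable_starTerm_idxB (m d : ℕ) : Summable (starTerm (idxB m d)) :=
  summable_starTerm (starOp_idxB_le_two m d)

theorem norm_zetaStar_le_two {s : List ℕ} (h : ∀ n, starOp ℝ s 1 n ≤ 2) :
    ‖(zetaStar s : ℂ)‖ ≤ 2 := by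
  rw [Complex.norm_real, zetaStar, Real.norm_of_nonneg (tsum_nonneg (starTerm_nonneg s))]
  exact le_of_tendsto' (tendsto_starOp_zetaStar (summable_starTerm h)) h

/-! ### Expansions in the weights `n!² / ((n - k)! (n + k)!)` -/

/-- The weight `n!² / ((n - k)! (n + k)!)`, which is `0` for `k > n`. -/
noncomputable def starWeight (n k : ℕ) : ℂ :=
  ∏ i ∈ Finset.range k, ((n : ℂ) - i) / (n + 1 + i)

theorem natCast_add_one_add_ne_zero (n k : ℕ) : (n : ℂ) + 1 + k ≠ 0 := by
  exact_mod_cast (by omega : n + 1 + k ≠ 0)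

theorem starWeight_zero_right (n : ℕ) : starWeight n 0 = 1 := by simp [starWeight]

theorem starWeight_succ (n k : ℕ) :
    (n + 1 + k) * starWeight n (k + 1) = (n - k) * starWeight n k := by
  have := natCast_add_one_add_ne_zero n k
  rw [starWeight, Finset.prod_range_succ, ← starWeight]
  field_simp

theorem starWeight_eq_zero {n k : ℕ} (h : n < k) : starWeight n k = 0 :=
  Finset.prod_eq_zero (Finset.mem_range.mpr h) (by simp)

/-- Equivalently w(n+1,k) - w(n,k) = k²/(n+1)² · w(n+1,k), so for k ≥ 1 the weight w(·,k) is an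
eigenvector of summation with exponent 2, with eigenvalue 1/k². -/
theorem starWeight_succ_left (n k : ℕ) :
    starWeight n k * (n + 1) ^ 2 = starWeight (n + 1) k * ((n + 1) ^ 2 - k ^ 2) := by
  induction k with
  | zero => simp [starWeight_zero_right]
  | succ k ih =>
    have h1 := natCast_add_one_add_ne_zero n k
    have h2 := natCast_add_one_add_ne_zero (n + 1) k
    have e1 := starWeight_succ n k
    have e2 := starWeight_succ (n + 1) k
    push_cast at h2 e2 ⊢
    apply mul_left_cancel₀ h1
    linear_combination (n + 1 : ℂ) ^ 2 * e1 + (n - k : ℂ) * ih -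
      ((n : ℂ) + 1 + k) * (n - k) * e2

theorem norm_starWeight_le_one (n k : ℕ) : ‖starWeight n k‖ ≤ 1 := by
  rw [starWeight, norm_prod]
  refine Finset.prod_le_one (fun _ _ => norm_nonneg _) fun i _ => ?_
  have h : ‖(n : ℂ) + 1 + i‖ = (n : ℝ) + 1 + i := by
    have : (n : ℂ) + 1 + i = ((n + 1 + i : ℕ) : ℂ) := by push_cast; ring
    rw [this, Complex.norm_natCast]
    push_cast
    ring
  rw [norm_div, h]
  refine div_le_one_of_le₀ ((norm_sub_le _ _).trans ?_) (by positivity)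
  rw [Complex.norm_natCast, Complex.norm_natCast]
  linarith

theorem tendsto_starWeight (k : ℕ) : Tendsto (fun n => starWeight n k) atTop (𝓝 1) := by
  have h : ∀ i ∈ Finset.range k,
      Tendsto (fun n : ℕ => ((n : ℂ) - i) / (n + 1 + i)) atTop (𝓝 1) := fun i _ => by
    -- Each factor is 1 - (2i+1)/(n+1+i).
    have h0 : Tendsto (fun n : ℕ => (2 * i + 1 : ℂ) / ((n + (i + 1) : ℕ) : ℂ)) atTop (𝓝 0) :=
      (tendsto_const_div_atTop_nhds_zero_nat (2 * i + 1 : ℂ)).comp (tendsto_add_atTop_nat (i + 1))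
    have h1 := h0.const_sub 1
    rw [sub_zero] at h1
    refine h1.congr fun n => ?_
    have := natCast_add_one_add_ne_zero n i
    have h2 : ((n + (i + 1) : ℕ) : ℂ) = n + 1 + i := by push_cast; ring
    rw [h2]
    field_simp
    ring
  simpa only [starWeight, Finset.prod_const_one] using tendsto_finsetProd _ h

/-- The sum `∑_{1 ≤ k ≤ n} c_k n!² / ((n - k)! (n + k)!)`, with `c k` standing for `c_{k + 1}`. -/
noncomputable def weightSum (c : ℕ → ℂ) (n : ℕ) : ℂ :=
  ∑ k ∈ Finset.range n, c k * starWeight n (k + 1)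

theorem mul_weightSum (a : ℂ) (c : ℕ → ℂ) (n : ℕ) :
    a * weightSum c n = weightSum (fun k => a * c k) n := by
  simp only [weightSum, Finset.mul_sum, mul_assoc]

theorem weightSum_add (c d : ℕ → ℂ) (n : ℕ) :
    weightSum (fun k => c k + d k) n = weightSum c n + weightSum d n := by
  simp only [weightSum, add_mul, Finset.sum_add_distrib]

theorem weightSum_succ_sub (c : ℕ → ℂ) (n : ℕ) :
    weightSum (fun k => c k / (k + 1) ^ 2) n + weightSum c (n + 1) / (n + 1) ^ 2 =
      weightSum (fun k => c k / (k + 1) ^ 2) (n + 1) := by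
  -- The term k = n vanishes, so it may be added to give all sums the same range.
  have h : weightSum (fun k => c k / (k + 1) ^ 2) n =
      ∑ k ∈ Finset.range (n + 1), c k / (k + 1) ^ 2 * starWeight n (k + 1) := by
    rw [Finset.sum_range_succ, starWeight_eq_zero (Nat.lt_succ_self n), mul_zero, add_zero,
      weightSum]
  rw [h, weightSum, weightSum, Finset.sum_div, ← Finset.sum_add_distrib]
  refine Finset.sum_congr rfl fun k _ => ?_
  have e := starWeight_succ_left n (k + 1)
  have h1 : (k : ℂ) + 1 ≠ 0 := Nat.cast_add_one_ne_zero k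
  have h2 : (n : ℂ) + 1 ≠ 0 := Nat.cast_add_one_ne_zero n
  push_cast at e
  field_simp
  linear_combination c k * e

theorem truncOp_two_weightSum (c : ℕ → ℂ) :
    truncOp ℂ 2 (fun n => weightSum c (n + 1)) =
      fun n => weightSum (fun k => c k / (k + 1) ^ 2) (n + 1) := by
  have h : ∀ N, ∑ j ∈ Finset.range N, weightSum c (j + 1) / ((j : ℂ) + 1) ^ 2 =
      weightSum (fun k => c k / (k + 1) ^ 2) N := fun N => by
    induction N with
    | zero => simp [weightSum]
    | succ N ih => rw [Finset.sum_range_succ, ih, weightSum_succ_sub]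
  funext n
  exact h (n + 1)

theorem starOp_replicate_two_weightSum (r : ℕ) (c : ℕ → ℂ) :
    starOp ℂ (List.replicate r 2) (fun n => weightSum c (n + 1)) =
      fun n => weightSum (fun k => c k / (k + 1) ^ (2 * r)) (n + 1) := by
  induction r with
  | zero => simp [starOp_nil]
  | succ r ih =>
    rw [List.replicate_succ, starOp_cons, ih, truncOp_two_weightSum]
    funext n
    congr 1
    funext k
    rw [div_div, ← pow_add]
    rfl

/-- Summation by parts against the weights. -/
theorem mul_weightSum_sub (E : ℕ → ℂ) (n : ℕ) :
    n * weightSum (fun k => E (k + 1) - E k) n =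
      weightSum (fun k => (k + 1) * (E (k + 1) + E k)) n - n * E 0 := by
  -- The weight keeps n fixed while the range N varies; the sum telescopes by `starWeight_succ`, and
  -- at N = n the boundary term is killed by the factor n - N.
  have h : ∀ N, ∑ k ∈ Finset.range N, (n * ((E (k + 1) - E k) * starWeight n (k + 1)) -
      (k + 1) * (E (k + 1) + E k) * starWeight n (k + 1)) =
      E N * ((n - N) * starWeight n N) - n * E 0 := fun N => by
    induction N with
    | zero => simp [starWeight_zero_right]; ring
    | succ N ih =>
      rw [Finset.sum_range_succ, ih]
      push_cast
      linear_combination -E N * starWeight_succ n N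
  have := h n
  rw [sub_self, zero_mul, mul_zero, Finset.sum_sub_distrib, ← Finset.mul_sum] at this
  rw [weightSum, weightSum]
  linear_combination this

/-- Summation by parts with E_k = -(-1)^k, for which E_(k+1) + E_k = 0. It places the constant
sequence 1 in the span of the weights. -/
theorem weightSum_alternating (n : ℕ) : weightSum (fun k => 2 * (-1) ^ k) (n + 1) = 1 := by
  have h := mul_weightSum_sub (fun k => -(-1) ^ k) (n + 1)
  have h0 : (n : ℂ) + 1 ≠ 0 := Nat.cast_add_one_ne_zero n
  have e1 : (fun k : ℕ => -(-1 : ℂ) ^ (k + 1) - -(-1) ^ k) = fun k => 2 * (-1) ^ k := by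
    funext k
    ring
  have e2 : (fun k : ℕ => ((k : ℂ) + 1) * (-(-1 : ℂ) ^ (k + 1) + -(-1) ^ k)) = fun _ => 0 := by
    funext k
    ring
  rw [e1, e2] at h
  apply mul_left_cancel₀ h0
  simpa [weightSum] using h

theorem starOp_replicate_two_one (m : ℕ) :
    starOp ℂ (List.replicate m 2) 1 =
      fun n => weightSum (fun k => 2 * (-1) ^ k / (k + 1) ^ (2 * m)) (n + 1) := by
  rw [← starOp_replicate_two_weightSum]
  congr 1
  funext n
  simp [weightSum_alternating]

theorem tendsto_weightSum {c : ℕ → ℂ} (hc : Summable fun k => ‖c k‖) :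
    Tendsto (weightSum c) atTop (𝓝 (∑' k, c k)) := by
  have h : ∀ n, weightSum c n = ∑' k, c k * starWeight n (k + 1) := fun n => by
    refine (tsum_eq_sum fun k hk => ?_).symm
    rw [starWeight_eq_zero (by simpa [Nat.lt_succ_iff] using hk), mul_zero]
  simp only [funext h]
  refine tendsto_tsum_of_dominated_convergence hc (fun k => ?_) (.of_forall fun n k => ?_)
  · simpa using (tendsto_starWeight (k + 1)).const_mul (c k)
  · rw [norm_mul]
    exact mul_le_of_le_one_right (norm_nonneg _) (norm_starWeight_le_one _ _)

/-! ### The finite products solving the functional equation -/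

/-- The product `∏_{1 ≤ j ≤ l} (1 + (-1)^j x / j^{2(m+1)}) / (1 - (-1)^j x / j^{2(m+1)})`. -/
noncomputable def starProd (m : ℕ) (x : ℂ) (l : ℕ) : ℂ :=
  ∏ k ∈ Finset.range l, (1 + (-1) ^ (k + 1) * (x / (k + 1) ^ (2 * (m + 1)))) /
    (1 - (-1) ^ (k + 1) * (x / (k + 1) ^ (2 * (m + 1))))

theorem starProd_zero (m : ℕ) (x : ℂ) : starProd m x 0 = 1 := by simp [starProd]

theorem norm_div_add_one_pow_le (x : ℂ) (k r : ℕ) : ‖x / ((k : ℂ) + 1) ^ r‖ ≤ ‖x‖ := by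
  have h : ‖(k : ℂ) + 1‖ = (k : ℝ) + 1 := by
    rw [← Nat.cast_succ, Complex.norm_natCast, Nat.cast_succ]
  rw [norm_div, norm_pow, h]
  exact div_le_self (norm_nonneg _) (one_le_pow₀ (by linarith [(Nat.cast_nonneg k : (0 : ℝ) ≤ k)]))

theorem one_sub_sign_mul_ne_zero {x : ℂ} (hx : ‖x‖ < 1) (j k r : ℕ) :
    1 - (-1) ^ j * (x / ((k : ℂ) + 1) ^ r) ≠ 0 := by
  intro h
  have h1 := congrArg norm (sub_eq_zero.mp h)
  rw [norm_mul, norm_pow, norm_neg, norm_one, one_pow, one_mul] at h1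
  linarith [norm_div_add_one_pow_le x k r]

/-- Consecutive products have ratio (1+q)/(1-q), which is the same as difference = q · sum. -/
theorem starProd_succ_sub {x : ℂ} (hx : ‖x‖ < 1) (m k : ℕ) :
    starProd m x (k + 1) - starProd m x k =
      (-1) ^ (k + 1) * (x / (k + 1) ^ (2 * (m + 1))) *
        (starProd m x (k + 1) + starProd m x k) := by
  have h := one_sub_sign_mul_ne_zero hx (k + 1) k (2 * (m + 1))
  rw [starProd, Finset.prod_range_succ, ← starProd]
  generalize (-1) ^ (k + 1) * (x / ((k : ℂ) + 1) ^ (2 * (m + 1))) = q at h ⊢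
  field_simp
  ring

/-- The generating function of the truncated sums, in closed form. -/
noncomputable def truncGen (m : ℕ) (x : ℂ) (n : ℕ) : ℂ :=
  1 + weightSum (fun k => starProd m x (k + 1) - starProd m x k) (n + 1)

theorem truncOp_one_truncGen (m : ℕ) (x : ℂ) :
    truncOp ℂ 1 (truncGen m x) = fun n =>
      weightSum (fun k => (starProd m x (k + 1) + starProd m x k) / (k + 1)) (n + 1) := by
  have h : truncOp ℂ 1 (truncGen m x) = truncOp ℂ 2 (fun n =>
      weightSum (fun k => (k + 1) * (starProd m x (k + 1) + starProd m x k)) (n + 1)) := by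
    funext n
    rw [truncOp_apply, truncOp_apply]
    refine Finset.sum_congr rfl fun j _ => ?_
    -- With E = P and P_0 = 1 the boundary term cancels the constant 1 in `truncGen`.
    have e := mul_weightSum_sub (starProd m x) (j + 1)
    have h0 : (j : ℂ) + 1 ≠ 0 := Nat.cast_add_one_ne_zero j
    rw [starProd_zero] at e
    push_cast at e
    rw [truncGen]
    field_simp
    linear_combination e
  rw [h, truncOp_two_weightSum]
  funext n
  congr 1
  funext k
  have h0 : (k : ℂ) + 1 ≠ 0 := Nat.cast_add_one_ne_zero k
  field_simp

theorem mul_truncOp_three_weightSum {x : ℂ} (hx : ‖x‖ < 1) (m : ℕ) :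
    x • truncOp ℂ 3 (fun n => weightSum (fun k =>
        (starProd m x (k + 1) + starProd m x k) / (k + 1) ^ (2 * m + 1)) (n + 1)) =
      fun n => weightSum (fun k => (-1) ^ (k + 1) *
        (starProd m x (k + 1) + starProd m x k - 2) / (k + 1) ^ 2) (n + 1) := by
  rw [← truncOp_two_weightSum, ← map_smul]
  funext n
  rw [truncOp_apply, truncOp_apply]
  refine Finset.sum_congr rfl fun j _ => ?_
  have h0 : (j : ℂ) + 1 ≠ 0 := Nat.cast_add_one_ne_zero j
  -- The sign (-1)^k interchanges sums and differences of P, so the recursion for P applies to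
  -- E_(k+1) + E_k; subtracting 1 makes E_0 = 0.
  have e := mul_weightSum_sub (fun k => (-1) ^ k * (starProd m x k - 1)) (j + 1)
  rw [starProd_zero] at e
  have e1 : (fun k : ℕ => (-1) ^ (k + 1) * (starProd m x (k + 1) - 1) -
      (-1) ^ k * (starProd m x k - 1)) =
      fun k => (-1) ^ (k + 1) * (starProd m x (k + 1) + starProd m x k - 2) := by
    funext k
    ring
  have e2 : (fun k : ℕ => ((k : ℂ) + 1) * ((-1) ^ (k + 1) * (starProd m x (k + 1) - 1) +
      (-1) ^ k * (starProd m x k - 1))) =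
      fun k => x * ((starProd m x (k + 1) + starProd m x k) / (k + 1) ^ (2 * m + 1)) := by
    funext k
    have h1 : (k : ℂ) + 1 ≠ 0 := Nat.cast_add_one_ne_zero k
    have h2 : ((-1 : ℂ) ^ (k + 1)) * (-1) ^ (k + 1) = 1 := by
      rw [← mul_pow]; simp
    have h3 : (-1 : ℂ) ^ (k + 1) * (starProd m x (k + 1) - starProd m x k) =
        x / (k + 1) ^ (2 * (m + 1)) * (starProd m x (k + 1) + starProd m x k) := by
      rw [starProd_succ_sub hx]
      linear_combination (x / (k + 1) ^ (2 * (m + 1)) *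
        (starProd m x (k + 1) + starProd m x k)) * h2
    have h4 : x * ((starProd m x (k + 1) + starProd m x k) / (k + 1) ^ (2 * m + 1)) =
        (k + 1) * (x / (k + 1) ^ (2 * (m + 1)) * (starProd m x (k + 1) + starProd m x k)) := by
      rw [show 2 * (m + 1) = 2 * m + 1 + 1 by ring, pow_succ _ (2 * m + 1)]
      field_simp
    rw [h4, ← h3]
    ring
  rw [e1, e2, ← mul_weightSum] at e
  push_cast at e
  simp only [Pi.smul_apply, smul_eq_mul]
  field_simp
  linear_combination -e

/-- By the recursion, the coefficients of x² T G are P_(k+1) - P_k plus a leftover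
2x(-1)^k/(k+1)^(2(m+1)), which is exactly the expansion of x B 1. -/
theorem truncGen_eq {x : ℂ} (hx : ‖x‖ < 1) (m : ℕ) :
    truncGen m x = (1 - x • starOp ℂ (List.replicate (m + 1) 2) 1) +
      x ^ 2 • starOp ℂ (starBlock m) (truncGen m x) := by
  have e : (fun k : ℕ => (starProd m x (k + 1) + starProd m x k) / ((k : ℂ) + 1) /
      (k + 1) ^ (2 * m)) =
      fun k => (starProd m x (k + 1) + starProd m x k) / (k + 1) ^ (2 * m + 1) := by
    funext k
    rw [div_div, pow_succ']
  have h : x • starOp ℂ (starBlock m) (truncGen m x) = fun n => weightSum (fun k => (-1) ^ (k + 1) *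
        (starProd m x (k + 1) + starProd m x k - 2) / (k + 1) ^ 2 / (k + 1) ^ (2 * m))
        (n + 1) := by
    rw [starOp_starBlock, ← map_smul, truncOp_one_truncGen, starOp_replicate_two_weightSum, e,
      mul_truncOp_three_weightSum hx, starOp_replicate_two_weightSum]
  rw [pow_two, mul_smul, h, starOp_replicate_two_one]
  funext n
  simp only [Pi.add_apply, Pi.sub_apply, Pi.smul_apply, Pi.one_apply, smul_eq_mul, truncGen]
  rw [mul_weightSum, mul_weightSum]
  have e3 : (fun k => starProd m x (k + 1) - starProd m x k) = fun k : ℕ =>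
      -1 * (x * (2 * (-1) ^ k / ((k : ℂ) + 1) ^ (2 * (m + 1)))) +
      x * ((-1) ^ (k + 1) * (starProd m x (k + 1) + starProd m x k - 2) / (k + 1) ^ 2 /
        (k + 1) ^ (2 * m)) := by
    funext k
    rw [starProd_succ_sub hx, div_div, ← pow_add, show 2 + 2 * m = 2 * (m + 1) by ring]
    ring
  rw [e3, weightSum_add, ← mul_weightSum (-1)]
  ring

/-! ### Convergence of the products and of the generating functions -/

theorem tendsto_starProd {x : ℂ} (hx : ‖x‖ < 1) (m : ℕ) :
    ∃ p, Tendsto (starProd m x) atTop (𝓝 p) := by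
  -- (1+q)/(1-q) = 1 + 2q/(1-q).
  set g : ℕ → ℂ := fun k => 2 * ((-1) ^ (k + 1) * (x / (k + 1) ^ (2 * (m + 1)))) /
    (1 - (-1) ^ (k + 1) * (x / (k + 1) ^ (2 * (m + 1)))) with hg
  have hsum : Summable fun k => ‖g k‖ := by
    have h0 : Summable fun k : ℕ => 2 / (1 - ‖x‖) * (1 / ((k + 1 : ℕ) : ℝ) ^ 2) :=
      (((summable_nat_add_iff 1).mpr
        (Real.summable_one_div_nat_pow.mpr one_lt_two)).mul_left _)
    refine Summable.of_nonneg_of_le (fun _ => norm_nonneg _) (fun k => ?_) h0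
    have h1 : ‖(-1 : ℂ) ^ (k + 1) * (x / (k + 1) ^ (2 * (m + 1)))‖ =
        ‖x / ((k : ℂ) + 1) ^ (2 * (m + 1))‖ := by
      rw [norm_mul, norm_pow, norm_neg, norm_one, one_pow, one_mul]
    have hk : ‖(k : ℂ) + 1‖ = ((k + 1 : ℕ) : ℝ) := by
      rw [← Nat.cast_succ, Complex.norm_natCast]
    have h2 : ‖x / ((k : ℂ) + 1) ^ (2 * (m + 1))‖ ≤ 1 / ((k + 1 : ℕ) : ℝ) ^ 2 := by
      rw [norm_div, norm_pow, hk]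
      have : (1 : ℝ) ≤ ((k + 1 : ℕ) : ℝ) := by exact_mod_cast Nat.succ_pos k
      exact div_le_div₀ zero_le_one hx.le (by positivity)
        (pow_le_pow_right₀ this (by omega))
    have h3 := norm_div_add_one_pow_le x k (2 * (m + 1))
    have h4 := norm_sub_norm_le 1 ((-1 : ℂ) ^ (k + 1) * (x / (k + 1) ^ (2 * (m + 1))))
    rw [norm_one, h1] at h4
    rw [hg]
    dsimp only
    rw [norm_div, norm_mul, h1, Complex.norm_ofNat, div_mul_eq_mul_div]
    exact div_le_div₀ (by positivity) (by gcongr) (by linarith) (by linarith)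
  refine ⟨_, (multipliable_one_add_of_summable hsum).hasProd.tendsto_prod_nat.congr fun l => ?_⟩
  refine Finset.prod_congr rfl fun k _ => ?_
  have h := one_sub_sign_mul_ne_zero hx (k + 1) k (2 * (m + 1))
  rw [hg]
  dsimp only
  generalize (-1) ^ (k + 1) * (x / ((k : ℂ) + 1) ^ (2 * (m + 1))) = q at h ⊢
  field_simp
  ring

theorem exists_norm_le_of_tendsto {f : ℕ → ℂ} {p : ℂ} (h : Tendsto f atTop (𝓝 p)) :
    ∃ c, ∀ n, ‖f n‖ ≤ c := by
  obtain ⟨c, hc⟩ := h.norm.bddAbove_range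
  exact ⟨c, fun n => hc ⟨n, rfl⟩⟩

theorem summable_starProd_sub {x : ℂ} (hx : ‖x‖ < 1) (m : ℕ) :
    Summable fun k => ‖starProd m x (k + 1) - starProd m x k‖ := by
  obtain ⟨p, hp⟩ := tendsto_starProd hx m
  obtain ⟨c, hc⟩ := exists_norm_le_of_tendsto hp
  have h0 : Summable fun k : ℕ => 1 / ((k + 1 : ℕ) : ℝ) ^ 2 * (c + c) :=
    (((summable_nat_add_iff 1).mpr
      (Real.summable_one_div_nat_pow.mpr one_lt_two)).mul_right _)
  refine Summable.of_nonneg_of_le (fun _ => norm_nonneg _) (fun k => ?_) h0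
  have hk : ‖(k : ℂ) + 1‖ = ((k + 1 : ℕ) : ℝ) := by
    rw [← Nat.cast_succ, Complex.norm_natCast]
  rw [starProd_succ_sub hx, norm_mul, norm_mul, norm_pow, norm_neg, norm_one, one_pow, one_mul,
    norm_div, norm_pow, hk]
  have : (1 : ℝ) ≤ ((k + 1 : ℕ) : ℝ) := by exact_mod_cast Nat.succ_pos k
  refine mul_le_mul (div_le_div₀ zero_le_one hx.le (by positivity)
    (pow_le_pow_right₀ this (by omega))) ?_ (norm_nonneg _) (by positivity)
  exact (norm_add_le _ _).trans (add_le_add (hc _) (hc _))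

theorem tendsto_truncGen {x p : ℂ} (hx : ‖x‖ < 1) (m : ℕ)
    (hp : Tendsto (starProd m x) atTop (𝓝 p)) : Tendsto (truncGen m x) atTop (𝓝 p) := by
  have hs := summable_starProd_sub hx m
  have h1 := (hs.of_norm).hasSum.tendsto_sum_nat
  simp only [Finset.sum_range_sub, starProd_zero] at h1
  have h2 := tendsto_nhds_unique h1 (hp.sub_const 1)
  have h3 := ((tendsto_weightSum hs).comp (tendsto_add_atTop_nat 1)).const_add 1
  rw [h2, add_sub_cancel] at h3
  exact h3

theorem truncGen_eq_sum_add {x : ℂ} (hx : ‖x‖ < 1) (m N : ℕ) :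
    truncGen m x = (∑ d ∈ Finset.range N,
        x ^ (2 * d) • (starOp ℂ (idxA m d) 1 - x • starOp ℂ (idxB m d) 1)) +
      x ^ (2 * N) • starOp ℂ (idxA m N) (truncGen m x) := by
  induction N with
  | zero => simp [starOp_idxA]
  | succ N ih =>
    have h : starOp ℂ (idxA m N) (truncGen m x) =
        (starOp ℂ (idxA m N) 1 - x • starOp ℂ (idxB m N) 1) +
          x ^ 2 • starOp ℂ (idxA m (N + 1)) (truncGen m x) := by
      conv_lhs => rw [truncGen_eq hx m]
      rw [map_add, map_sub, map_smul, map_smul, starOp_idxB, starOp_idxA, starOp_idxA,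
        pow_succ (starOp ℂ (starBlock m)), Module.End.mul_apply, Module.End.mul_apply]
    rw [Finset.sum_range_succ, add_assoc, mul_add, mul_one, pow_add, mul_smul, ← smul_add, ← h]
    exact ih

theorem norm_starOp_one_le_two {s : List ℕ} (h : ∀ n, starOp ℝ s 1 n ≤ 2) (n : ℕ) :
    ‖starOp ℂ s 1 n‖ ≤ 2 := by
  have h0 : 0 ≤ starOp ℝ s 1 n := starOp_nonneg s (fun _ => zero_le_one) n
  rw [starOp_one_ofReal, Complex.norm_real, Real.norm_of_nonneg h0]
  exact h n

theorem norm_pow_mul_sub_le {x a b : ℂ} (hx : ‖x‖ < 1) (ha : ‖a‖ ≤ 2) (hb : ‖b‖ ≤ 2) (d : ℕ) :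
    ‖x ^ (2 * d) * (a - x * b)‖ ≤ (‖x‖ ^ 2) ^ d * 4 := by
  rw [norm_mul, norm_pow, pow_mul]
  gcongr
  refine (norm_sub_le _ _).trans ?_
  rw [norm_mul]
  nlinarith [norm_nonneg x, norm_nonneg b]

theorem summable_sq_norm_pow {x : ℂ} (hx : ‖x‖ < 1) (c : ℝ) :
    Summable fun d : ℕ => (‖x‖ ^ 2) ^ d * c :=
  (summable_geometric_of_lt_one (by positivity)
    (pow_lt_one₀ (norm_nonneg x) hx two_ne_zero)).mul_right c

theorem truncGen_eq_tsum {x : ℂ} (hx : ‖x‖ < 1) (m n : ℕ) :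
    truncGen m x n = ∑' d : ℕ,
      x ^ (2 * d) * (starOp ℂ (idxA m d) 1 n - x * starOp ℂ (idxB m d) 1 n) := by
  have hs : Summable fun d : ℕ =>
      x ^ (2 * d) * (starOp ℂ (idxA m d) 1 n - x * starOp ℂ (idxB m d) 1 n) :=
    Summable.of_norm_bounded (summable_sq_norm_pow hx 4) fun d =>
      norm_pow_mul_sub_le hx (norm_starOp_one_le_two (starOp_idxA_le_two m d) n)
        (norm_starOp_one_le_two (starOp_idxB_le_two m d) n) d
  obtain ⟨p, hp⟩ := tendsto_starProd hx m
  obtain ⟨c, hc⟩ := exists_norm_le_of_tendsto (tendsto_truncGen hx m hp)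
  have hc0 : 0 ≤ c := (norm_nonneg _).trans (hc 0)
  -- The remainder is at most ‖x‖^(2N) c · `majorant n`, with c a bound for G.
  have hr : Tendsto (fun N => x ^ (2 * N) * starOp ℂ (idxA m N) (truncGen m x) n) atTop (𝓝 0) := by
    refine squeeze_zero_norm (fun N => ?_)
      (summable_sq_norm_pow hx (c * majorant n)).tendsto_atTop_zero
    rw [norm_mul, norm_pow, pow_mul]
    gcongr
    refine (norm_starOp_le _ _ _).trans ?_
    rw [starOp_idxA]
    refine starOp_starBlock_pow_le_majorant m N (fun _ => norm_nonneg _) (fun k => ?_) n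
    exact (hc k).trans (le_mul_of_one_le_right hc0 (one_le_majorant k))
  have h := hs.hasSum.tendsto_sum_nat.add hr
  rw [add_zero] at h
  refine tendsto_nhds_unique (tendsto_const_nhds.congr fun N => ?_) h
  have := congrFun (truncGen_eq_sum_add hx m N) n
  simpa only [Pi.add_apply, Finset.sum_apply, Pi.smul_apply, Pi.sub_apply, smul_eq_mul] using this

theorem tsum_zetaStar_eq {x p : ℂ} (hx : ‖x‖ < 1) (m : ℕ)
    (hp : Tendsto (starProd m x) atTop (𝓝 p)) :
    ∑' d : ℕ, x ^ (2 * d) * ((zetaStar (idxA m d) : ℂ) - x * zetaStar (idxB m d)) = p := by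
  have hlim : ∀ s, Summable (starTerm s) →
      Tendsto (fun n => starOp ℂ s 1 n) atTop (𝓝 (zetaStar s : ℂ)) := fun s hs => by
    simp only [starOp_one_ofReal]
    exact (Complex.continuous_ofReal.tendsto _).comp (tendsto_starOp_zetaStar hs)
  refine tendsto_nhds_unique ?_ (tendsto_truncGen hx m hp)
  simp only [funext (truncGen_eq_tsum hx m)]
  refine tendsto_tsum_of_dominated_convergence (summable_sq_norm_pow hx 4) (fun d => ?_)
    (.of_forall fun n d => ?_)
  · exact ((hlim _ (summable_starTerm_idxA m d)).sub
      ((hlim _ (summable_starTerm_idxB m d)).const_mul x)).const_mul _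
  · exact norm_pow_mul_sub_le hx (norm_starOp_one_le_two (starOp_idxA_le_two m d) n)
      (norm_starOp_one_le_two (starOp_idxB_le_two m d) n) d

theorem norm_zetaStar_idxA_mul_le (m d : ℕ) (z : ℂ) :
    ‖(zetaStar (idxA m d) : ℂ) * z ^ (4 * (m + 1) * d)‖ ≤ (‖z ^ (2 * (m + 1))‖ ^ 2) ^ d * 2 := by
  have e : z ^ (4 * (m + 1) * d) = ((z ^ (2 * (m + 1))) ^ 2) ^ d := by
    ring
  rw [e, norm_mul, norm_pow, norm_pow, mul_comm]
  gcongr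
  exact norm_zetaStar_le_two (starOp_idxA_le_two m d)

theorem norm_zetaStar_idxB_mul_le (m d : ℕ) {z : ℂ} (hz : ‖z‖ < 1) :
    ‖(zetaStar (idxB m d) : ℂ) * z ^ (2 * (m + 1) * (2 * d + 1))‖ ≤
      (‖z ^ (2 * (m + 1))‖ ^ 2) ^ d * 2 := by
  have e : z ^ (2 * (m + 1) * (2 * d + 1)) =
      ((z ^ (2 * (m + 1))) ^ 2) ^ d * z ^ (2 * (m + 1)) := by
    ring
  have h1 : ‖z ^ (2 * (m + 1))‖ ≤ 1 := by
    rw [norm_pow]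
    exact pow_le_one₀ (norm_nonneg z) hz.le
  rw [e, norm_mul, norm_mul, norm_pow, norm_pow, mul_comm]
  refine mul_le_mul (mul_le_of_le_one_right (by positivity) h1)
    (norm_zetaStar_le_two (starOp_idxB_le_two m d)) (norm_nonneg _) (by positivity)

theorem norm_pow_two_mul_succ_lt_one (m : ℕ) {z : ℂ} (hz : ‖z‖ < 1) :
    ‖z ^ (2 * (m + 1))‖ < 1 := by
  rw [norm_pow]
  exact pow_lt_one₀ (norm_nonneg z) hz (by omega)

theorem summable_zetaStar_idxA (m : ℕ) {z : ℂ} (hz : ‖z‖ < 1) :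
    Summable fun d : ℕ => (zetaStar (idxA m d) : ℂ) * z ^ (4 * (m + 1) * d) :=
  Summable.of_norm_bounded (summable_sq_norm_pow (norm_pow_two_mul_succ_lt_one m hz) 2)
    fun d => norm_zetaStar_idxA_mul_le m d z

theorem summable_zetaStar_idxB (m : ℕ) {z : ℂ} (hz : ‖z‖ < 1) :
    Summable fun d : ℕ => (zetaStar (idxB m d) : ℂ) * z ^ (2 * (m + 1) * (2 * d + 1)) :=
  Summable.of_norm_bounded (summable_sq_norm_pow (norm_pow_two_mul_succ_lt_one m hz) 2)
    fun d => norm_zetaStar_idxB_mul_le m d hz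

theorem starGenFun_eq_of_tendsto (m : ℕ) {z p : ℂ} (hz : ‖z‖ < 1)
    (hp : Tendsto (starProd m (z ^ (2 * (m + 1)))) atTop (𝓝 p)) : starGenFun m z = p := by
  rw [starGenFun, ← (summable_zetaStar_idxA m hz).tsum_sub (summable_zetaStar_idxB m hz),
    ← tsum_zetaStar_eq (norm_pow_two_mul_succ_lt_one m hz) m hp]
  refine tsum_congr fun d => ?_
  rw [show 4 * (m + 1) * d = 2 * (m + 1) * (2 * d) by ring,
    show 2 * (m + 1) * (2 * d + 1) = 2 * (m + 1) * (2 * d) + 2 * (m + 1) by ring, pow_add, pow_mul]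
  ring

theorem continuousAt_starGenFun_zero (m : ℕ) : ContinuousAt (starGenFun m) 0 := by
  have hr : ‖((1 / 2 : ℂ)) ^ (2 * (m + 1))‖ < 1 :=
    norm_pow_two_mul_succ_lt_one m (by norm_num)
  have hlt : ∀ z ∈ Metric.ball (0 : ℂ) (1 / 2), ‖z‖ < 1 / 2 := fun z hz => by simpa using hz
  have hle : ∀ d, ∀ z ∈ Metric.ball (0 : ℂ) (1 / 2),
      (‖z ^ (2 * (m + 1))‖ ^ 2) ^ d * 2 ≤ (‖(1 / 2 : ℂ) ^ (2 * (m + 1))‖ ^ 2) ^ d * 2 := by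
    intro d z hz
    have h := hlt z hz
    have e : ‖(1 / 2 : ℂ)‖ = 1 / 2 := by norm_num
    rw [norm_pow, norm_pow, e]
    gcongr
  have hnhds : Metric.ball (0 : ℂ) (1 / 2) ∈ 𝓝 0 := Metric.ball_mem_nhds _ (by norm_num)
  refine ContinuousAt.sub ?_ ?_
  · refine (continuousOn_tsum (fun d => ?_) (summable_sq_norm_pow hr 2)
      fun d z hz => ?_).continuousAt hnhds
    · fun_prop
    · exact (norm_zetaStar_idxA_mul_le m d z).trans (hle d z hz)
  · refine (continuousOn_tsum (fun d => ?_) (summable_sq_norm_pow hr 2)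
      fun d z hz => ?_).continuousAt hnhds
    · fun_prop
    · exact (norm_zetaStar_idxB_mul_le m d ((hlt z hz).trans (by norm_num))).trans (hle d z hz)

/-! ### Evaluation of the infinite product -/

theorem prod_one_sub_mul_exp (m : ℕ) (y : ℂ) :
    ∏ k ∈ Finset.range (m + 1), (1 - y * Complex.exp (Real.pi * Complex.I * k / (m + 1)) ^ 2) =
      1 - y ^ (m + 1) := by
  have hζ := Complex.isPrimitiveRoot_exp (m + 1) (Nat.succ_ne_zero m)
  have h := congrArg (Polynomial.eval 1)
    (X_pow_sub_C_eq_prod hζ (Nat.succ_pos m) (rfl : y ^ (m + 1) = y ^ (m + 1)))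
  rw [Polynomial.eval_prod] at h
  simp only [Polynomial.eval_sub, Polynomial.eval_pow, Polynomial.eval_X, Polynomial.eval_C,
    one_pow] at h
  rw [h]
  refine Finset.prod_congr rfl fun k _ => ?_
  rw [mul_comm, ← Complex.exp_nat_mul, ← Complex.exp_nat_mul]
  congr 3
  push_cast
  ring

theorem exp_odd_eq (m k : ℕ) :
    Complex.exp (Real.pi * Complex.I * (2 * k + 1) / (2 * (m + 1))) =
      Complex.exp (Real.pi * Complex.I / (2 * (m + 1))) *
        Complex.exp (Real.pi * Complex.I * k / (m + 1)) := by
  have h : (m : ℂ) + 1 ≠ 0 := Nat.cast_add_one_ne_zero m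
  rw [← Complex.exp_add]
  congr 1
  field_simp
  ring

theorem exp_half_pow (m : ℕ) :
    Complex.exp (Real.pi * Complex.I / (2 * (m + 1))) ^ (m + 1) = Complex.I := by
  have h : (m : ℂ) + 1 ≠ 0 := Nat.cast_add_one_ne_zero m
  have e : ((m + 1 : ℕ) : ℂ) * (Real.pi * Complex.I / (2 * (m + 1))) =
      Real.pi / 2 * Complex.I := by
    push_cast
    field_simp
  rw [← Complex.exp_nat_mul, e, Complex.exp_pi_div_two_mul_I]

/-- The odd exponents are the even ones rotated by exp(πi/(2(m+1))), whose 2(m+1)-th power is -1. -/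
theorem prod_one_sub_mul_exp_odd (m : ℕ) (y : ℂ) :
    ∏ k ∈ Finset.range (m + 1),
        (1 - y * Complex.exp (Real.pi * Complex.I * (2 * k + 1) / (2 * (m + 1))) ^ 2) =
      1 + y ^ (m + 1) := by
  have h := prod_one_sub_mul_exp m (y * Complex.exp (Real.pi * Complex.I / (2 * (m + 1))) ^ 2)
  rw [mul_pow, pow_right_comm, exp_half_pow, Complex.I_sq] at h
  rw [show 1 + y ^ (m + 1) = 1 - y ^ (m + 1) * -1 by ring, ← h]
  refine Finset.prod_congr rfl fun k _ => ?_
  rw [exp_odd_eq]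
  ring

/-- The partial products of `sin (π w) / (π w)`. -/
noncomputable def sineProd (w : ℂ) (N : ℕ) : ℂ :=
  ∏ j ∈ Finset.range N, (1 - w ^ 2 / ((j : ℂ) + 1) ^ 2)

theorem tendsto_sineProd {w : ℂ} (hw : w ≠ 0) :
    Tendsto (sineProd w) atTop (𝓝 (Complex.sin (Real.pi * w) / (Real.pi * w))) := by
  have h0 : (Real.pi : ℂ) * w ≠ 0 := mul_ne_zero (Complex.ofReal_ne_zero.mpr Real.pi_ne_zero) hw
  refine ((Complex.tendsto_euler_sin_prod w).div_const (Real.pi * w)).congr fun N => ?_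
  rw [mul_div_cancel_left₀ _ h0, sineProd]

theorem sin_pi_mul_ne_zero_of_norm_lt_one {w : ℂ} (h0 : w ≠ 0) (h1 : ‖w‖ < 1) :
    Complex.sin (Real.pi * w) ≠ 0 := by
  intro h
  obtain ⟨k, hk⟩ := Complex.sin_eq_zero_iff.mp h
  have hpi : (Real.pi : ℂ) ≠ 0 := Complex.ofReal_ne_zero.mpr Real.pi_ne_zero
  have hw : w = k := by
    apply mul_left_cancel₀ hpi
    rw [hk, mul_comm]
  rw [hw, Complex.norm_intCast] at h1
  have hk0 : k = 0 := Int.abs_lt_one_iff.mp (by exact_mod_cast h1)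
  exact h0 (by rw [hw, hk0, Int.cast_zero])

theorem prod_sineProd_exp (m N : ℕ) (z : ℂ) :
    ∏ k ∈ Finset.range (m + 1),
        sineProd (z * Complex.exp (Real.pi * Complex.I * k / (m + 1))) N =
      ∏ j ∈ Finset.range N, (1 - z ^ (2 * (m + 1)) / ((j : ℂ) + 1) ^ (2 * (m + 1))) := by
  simp only [sineProd]
  rw [Finset.prod_comm]
  refine Finset.prod_congr rfl fun j _ => ?_
  rw [pow_mul, pow_mul, ← div_pow, ← prod_one_sub_mul_exp]
  refine Finset.prod_congr rfl fun k _ => ?_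
  ring

theorem prod_sineProd_exp_odd (m N : ℕ) (z : ℂ) :
    ∏ k ∈ Finset.range (m + 1),
        sineProd (z * Complex.exp (Real.pi * Complex.I * (2 * k + 1) / (2 * (m + 1)))) N =
      ∏ j ∈ Finset.range N, (1 + z ^ (2 * (m + 1)) / ((j : ℂ) + 1) ^ (2 * (m + 1))) := by
  simp only [sineProd]
  rw [Finset.prod_comm]
  refine Finset.prod_congr rfl fun j _ => ?_
  rw [pow_mul, pow_mul, ← div_pow, ← prod_one_sub_mul_exp_odd]
  refine Finset.prod_congr rfl fun k _ => ?_
  ring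

/-- Odd j contribute (1-q)/(1+q) and even j its inverse. Taking (1-q)/(1+q) for all j ≤ 2N must be
corrected at even j by the square of (1+q)/(1-q); writing j = 2i replaces z by z/2. -/
theorem starProd_two_mul {z : ℂ} (hz : ‖z‖ < 1) (m N : ℕ) :
    starProd m (z ^ (2 * (m + 1))) (2 * N) =
      (∏ j ∈ Finset.range (2 * N), (1 - z ^ (2 * (m + 1)) / ((j : ℂ) + 1) ^ (2 * (m + 1)))) /
      (∏ j ∈ Finset.range (2 * N), (1 + z ^ (2 * (m + 1)) / ((j : ℂ) + 1) ^ (2 * (m + 1)))) *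
      ((∏ j ∈ Finset.range N,
          (1 + (z / 2) ^ (2 * (m + 1)) / ((j : ℂ) + 1) ^ (2 * (m + 1)))) /
        (∏ j ∈ Finset.range N,
          (1 - (z / 2) ^ (2 * (m + 1)) / ((j : ℂ) + 1) ^ (2 * (m + 1))))) ^ 2 := by
  have hx := norm_pow_two_mul_succ_lt_one m hz
  rw [starProd]
  induction N with
  | zero => simp
  | succ N ih =>
    rw [mul_add, mul_one, Finset.prod_range_succ, Finset.prod_range_succ, ih]
    simp only [Finset.prod_range_succ]
    have h1 := one_sub_sign_mul_ne_zero hx 0 (2 * N + 1) (2 * (m + 1))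
    have h2 := one_sub_sign_mul_ne_zero hx 1 (2 * N + 1) (2 * (m + 1))
    have e : (z / 2) ^ (2 * (m + 1)) / ((N : ℂ) + 1) ^ (2 * (m + 1)) =
        z ^ (2 * (m + 1)) / (((2 * N + 1 : ℕ) : ℂ) + 1) ^ (2 * (m + 1)) := by
      rw [← div_pow, ← div_pow]
      congr 1
      push_cast
      rw [show (2 * N + 1 + 1 : ℂ) = 2 * (N + 1) by ring, div_div]
    rw [e, show (-1 : ℂ) ^ (2 * N + 1) = -1 by rw [pow_succ, pow_mul]; simp,
      show (-1 : ℂ) ^ (2 * N + 1 + 1) = 1 by rw [add_assoc, pow_add, pow_mul]; simp]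
    generalize z ^ (2 * (m + 1)) / (((2 * N + 1 : ℕ) : ℂ) + 1) ^ (2 * (m + 1)) = q at h1 h2 ⊢
    simp only [pow_zero, pow_one, one_mul, neg_mul, sub_neg_eq_add, ← sub_eq_add_neg] at h1 h2 ⊢
    simp only [div_eq_mul_inv, mul_inv, mul_pow]
    have h3 : (1 - q) * (1 - q)⁻¹ = 1 := mul_inv_cancel₀ h1
    have h4 : (1 + q) * (1 + q)⁻¹ = 1 := mul_inv_cancel₀ h2
    generalize (1 - q)⁻¹ = a at h3 ⊢
    generalize (1 + q)⁻¹ = b at h4 ⊢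
    have h5 : (1 - q) * b * ((1 + q) ^ 2 * a ^ 2) = (1 + q) * a := by
      linear_combination (1 + q) ^ 2 * b * a * h3 + (1 + q) * a * h4
    rw [← h5]
    ring

theorem sine_quotient_eq {a b : ℂ} (ha : a ≠ 0) (hb : b ≠ 0) (hsa : Complex.sin a ≠ 0)
    (hsb : Complex.sin (2 * b) ≠ 0) :
    Complex.sin (2 * a) / (2 * a) / (Complex.sin (2 * b) / (2 * b)) *
        (Complex.sin b / b / (Complex.sin a / a)) ^ 2 =
      a / b * (Complex.tan b * Complex.cot a) := by
  rw [Complex.sin_two_mul] at hsb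
  have h1 : Complex.sin b ≠ 0 := fun h => hsb (by rw [h]; ring)
  have h2 : Complex.cos b ≠ 0 := fun h => hsb (by rw [h]; ring)
  rw [Complex.sin_two_mul, Complex.sin_two_mul, Complex.tan_eq_sin_div_cos, Complex.cot]
  field_simp

theorem tendsto_starProd_tanCotProd (m : ℕ) {z : ℂ} (hz : ‖z‖ < 1) (hz0 : z ≠ 0) :
    Tendsto (starProd m (z ^ (2 * (m + 1)))) atTop (𝓝 (tanCotProd m z)) := by
  -- The limit exists, so evaluating it along even indices suffices.
  obtain ⟨p, hp⟩ := tendsto_starProd (norm_pow_two_mul_succ_lt_one m hz) m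
  have h2 : Tendsto (fun N : ℕ => 2 * N) atTop atTop :=
    tendsto_id.const_mul_atTop' two_pos
  have hp2 := hp.comp h2
  set ω : ℕ → ℂ := fun k => Complex.exp (Real.pi * Complex.I * k / (m + 1)) with hω
  set η : ℕ → ℂ := fun k =>
    Complex.exp (Real.pi * Complex.I * (2 * k + 1) / (2 * (m + 1))) with hη
  have hpi : (Real.pi : ℂ) ≠ 0 := Complex.ofReal_ne_zero.mpr Real.pi_ne_zero
  have hω0 : ∀ k, ω k ≠ 0 := fun k => Complex.exp_ne_zero _
  have hη0 : ∀ k, η k ≠ 0 := fun k => Complex.exp_ne_zero _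
  have hω1 : ∀ k, ‖ω k‖ = 1 := fun k => by
    have : Real.pi * Complex.I * k / (m + 1) = ((Real.pi * k / (m + 1) : ℝ) : ℂ) * Complex.I := by
      push_cast
      ring
    rw [hω]
    dsimp only
    rw [this, Complex.norm_exp_ofReal_mul_I]
  have hη1 : ∀ k, ‖η k‖ = 1 := fun k => by
    have : Real.pi * Complex.I * (2 * k + 1) / (2 * (m + 1)) =
        ((Real.pi * (2 * k + 1) / (2 * (m + 1)) : ℝ) : ℂ) * Complex.I := by
      push_cast
      ring
    rw [hη]
    dsimp only
    rw [this, Complex.norm_exp_ofReal_mul_I]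
  have hz2 : z / 2 ≠ 0 := div_ne_zero hz0 two_ne_zero
  have hsω : ∀ k, Complex.sin (Real.pi * (z / 2 * ω k)) ≠ 0 := fun k => by
    refine sin_pi_mul_ne_zero_of_norm_lt_one (mul_ne_zero hz2 (hω0 k)) ?_
    rw [norm_mul, hω1, mul_one, norm_div, Complex.norm_ofNat]
    linarith [norm_nonneg z]
  have hsη : ∀ k, Complex.sin (Real.pi * (z * η k)) ≠ 0 := fun k => by
    refine sin_pi_mul_ne_zero_of_norm_lt_one (mul_ne_zero hz0 (hη0 k)) ?_
    rwa [norm_mul, hη1, mul_one]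
  have hlim : Tendsto (fun N => ∏ k ∈ Finset.range (m + 1),
      (sineProd (z * ω k) (2 * N) / sineProd (z * η k) (2 * N) *
        (sineProd (z / 2 * η k) N / sineProd (z / 2 * ω k) N) ^ 2)) atTop
      (𝓝 (∏ k ∈ Finset.range (m + 1),
        (ω k / η k * (Complex.tan (Real.pi * z / 2 * η k) *
          Complex.cot (Real.pi * z / 2 * ω k))))) := by
    refine tendsto_finsetProd _ fun k _ => ?_
    have t1 := (tendsto_sineProd (mul_ne_zero hz0 (hω0 k))).comp h2
    have t2 := (tendsto_sineProd (mul_ne_zero hz0 (hη0 k))).comp h2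
    have t3 := tendsto_sineProd (mul_ne_zero hz2 (hη0 k))
    have t4 := tendsto_sineProd (mul_ne_zero hz2 (hω0 k))
    have t := (t1.div t2 (div_ne_zero (hsη k) (mul_ne_zero hpi (mul_ne_zero hz0 (hη0 k))))).mul
      ((t3.div t4 (div_ne_zero (hsω k) (mul_ne_zero hpi (mul_ne_zero hz2 (hω0 k))))).pow 2)
    have e1 : (Real.pi : ℂ) * (z * ω k) = 2 * (Real.pi * z / 2 * ω k) := by ring
    have e2 : (Real.pi : ℂ) * (z * η k) = 2 * (Real.pi * z / 2 * η k) := by ring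
    have e3 : (Real.pi : ℂ) * (z / 2 * η k) = Real.pi * z / 2 * η k := by ring
    have e4 : (Real.pi : ℂ) * (z / 2 * ω k) = Real.pi * z / 2 * ω k := by ring
    have hc : (Real.pi : ℂ) * z / 2 ≠ 0 := div_ne_zero (mul_ne_zero hpi hz0) two_ne_zero
    have h3 := hsω k
    have h4 := hsη k
    rw [e4] at h3
    rw [e2] at h4
    rw [e1, e2, e3, e4, sine_quotient_eq (mul_ne_zero hc (hω0 k)) (mul_ne_zero hc (hη0 k)) h3 h4,
      mul_div_mul_left _ _ hc] at t
    exact t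
  have heq : ∀ N, ∏ k ∈ Finset.range (m + 1),
      (sineProd (z * ω k) (2 * N) / sineProd (z * η k) (2 * N) *
        (sineProd (z / 2 * η k) N / sineProd (z / 2 * ω k) N) ^ 2) =
      starProd m (z ^ (2 * (m + 1))) (2 * N) := fun N => by
    rw [Finset.prod_mul_distrib, Finset.prod_div_distrib, Finset.prod_pow,
      Finset.prod_div_distrib, prod_sineProd_exp, prod_sineProd_exp_odd, prod_sineProd_exp,
      prod_sineProd_exp_odd, starProd_two_mul hz]
  -- Each quotient is exp(-πi/(2(m+1))); the m + 1 of them multiply to exp(-πi/2).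
  have hprod : ∏ k ∈ Finset.range (m + 1), (ω k / η k) = -Complex.I := by
    have h : ∀ k ∈ Finset.range (m + 1),
        ω k / η k = (Complex.exp (Real.pi * Complex.I / (2 * (m + 1))))⁻¹ := fun k _ => by
      rw [hη]
      dsimp only
      rw [exp_odd_eq, ← div_div, div_right_comm, div_self (hω0 k), one_div]
    rw [Finset.prod_congr rfl h, Finset.prod_const, Finset.card_range, inv_pow, exp_half_pow,
      Complex.inv_I]
  rw [Finset.prod_mul_distrib, hprod] at hlim
  have : p = tanCotProd m z := tendsto_nhds_unique hp2 (hlim.congr heq)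
  rwa [this] at hp

theorem starGenFun_eq_tanCotProd (m : ℕ) {z : ℂ} (hz : ‖z‖ < 1) (hz0 : z ≠ 0) :
    starGenFun m z = tanCotProd m z :=
  starGenFun_eq_of_tendsto m hz (tendsto_starProd_tanCotProd m hz hz0)

theorem theorem3p2 (m : ℕ) :
    (∀ d : ℕ, Summable (starTerm (idxA m d)) ∧ Summable (starTerm (idxB m d))) ∧
    (∀ z : ℂ, ‖z‖ < 1 →
      Summable (fun d : ℕ => (zetaStar (idxA m d) : ℂ) * z ^ (4 * (m + 1) * d)) ∧
      Summable (fun d : ℕ => (zetaStar (idxB m d) : ℂ) * z ^ (2 * (m + 1) * (2 * d + 1))) ∧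
      (z ≠ 0 → starGenFun m z = tanCotProd m z)) ∧
    Tendsto (tanCotProd m) (𝓝[≠] 0) (𝓝 (starGenFun m 0)) := by
  refine ⟨fun d => ⟨summable_starTerm_idxA m d, summable_starTerm_idxB m d⟩,
    fun z hz => ⟨summable_zetaStar_idxA m hz, summable_zetaStar_idxB m hz,
      starGenFun_eq_tanCotProd m hz⟩, ?_⟩
  -- The series are continuous at 0 and agree with the product on the punctured disc.
  refine ((continuousAt_starGenFun_zero m).tendsto.mono_left nhdsWithin_le_nhds).congr' ?_
  filter_upwards [self_mem_nhdsWithin,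
    nhdsWithin_le_nhds (Metric.ball_mem_nhds (0 : ℂ) one_pos)] with z hz0 hz
  exact starGenFun_eq_tanCotProd m (by simpa using hz) hz0
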